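/- Let $\Bbbk$ be a field, $R=\Bbbk[x_0,\dots,x_n]$ ($n\ge 0$) and $\mathfrak m=(x_0,\dots,x_n)$. Let $I\subset R$ be a nonzero proper monomial ideal that is equigenerated, i.e. all of its minimal monomial generators have the same degree. We use the following notation. - $\operatorname{Ass}(I)$ is the set of associated primes of $R/I$, and $\operatorname{maxAss}(I)$ is the set of its elements that are maximal under inclusion. - $e$ is the big-height of $I$, i.e. the maximum of the heights of the primes in $\operatorname{Ass}(I)$. - $I^{(m)}=\bigcap_{P\in\operatorname{Ass}(I)}(R\cap I^mR_P)$ is the $m$-th symbolic power of $I$, for $m\ge 0$. - $\alpha(I)$ is the least degree of a nonzero homogeneous element of $I$. - $\mathcal Q\subseteq\mathbb R^{n+1}$ is the symbolic polyhedron of $I$, $$\mathcal Q=\bigcap_{P\in\operatorname{maxAss}(I)}\operatorname{conv}\{\mathbf a\in\mathbb N^{n+1} : \mathbf x^{\mathbf a}\in R\cap IR_P\},$$ and $\alpha(\mathcal Q)=\min\{a_0+\cdots+a_n : (a_0,\dots,a_n)\in\mathcal Q\}$. If $$\alpha(\mathcal Q)\ \ge\ \frac{\alpha(I)+e-1}{e},$$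 then $I^{(er)}\subseteq \mathfrak m^{(e-1)r}I^r$ for all integers $r\ge 0$. -/

import Mathlib

open MvPolynomial

namespace MonomialSymbolic

noncomputable section

/-- The contraction `R ∩ J R_P` of the extension of the ideal `J` to the localization `R_P`. -/
def localContraction {R : Type*} [CommRing R] (J : Ideal R) (P : PrimeSpectrum R) : Ideal R :=
  Ideal.comap (algebraMap R (Localization.AtPrime P.asIdeal))
    (Ideal.map (algebraMap R (Localization.AtPrime P.asIdeal)) J)

/-- `Ass(I)`, the set of associated primes of the `R`-module `R / I`. -/
def ass {R : Type*} [CommRing R] (I : Ideal R) : Set (PrimeSpectrum R) :=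
  {P | P.asIdeal ∈ associatedPrimes R (R ⧸ I)}

/-- `maxAss(I)`, the associated primes of `I` that are maximal with respect to inclusion. -/
def maxAss {R : Type*} [CommRing R] (I : Ideal R) : Set (PrimeSpectrum R) :=
  {P | Maximal (· ∈ ass I) P}

/-- The `m`-th symbolic power `I^(m) = ⋂_{P ∈ Ass(I)} (R ∩ I^m R_P)`. -/
def symbolicPower {R : Type*} [CommRing R] (I : Ideal R) (m : ℕ) : Ideal R :=
  ⨅ P ∈ ass I, localContraction (I ^ m) P

/-- The big-height of `I`: the maximum of the heights of its associated primes. -/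
def bigHeight {R : Type*} [CommRing R] (I : Ideal R) : ℕ∞ :=
  ⨆ P ∈ ass I, P.asIdeal.height

section Polynomial

variable {σ K : Type*} [Field K]

/-- A monomial ideal is an ideal generated by a set of monomials. -/
def IsMonomialIdeal (I : Ideal (MvPolynomial σ K)) : Prop :=
  ∃ S : Set (σ →₀ ℕ), I = Ideal.span ((fun a => monomial a (1 : K)) '' S)

/-- The set `L(I)` of exponent vectors of the monomials in `I`. -/
def exponents (I : Ideal (MvPolynomial σ K)) : Set (σ →₀ ℕ) :=
  {a | monomial a (1 : K) ∈ I}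

/-- The exponent vectors of the minimal monomial generators of a monomial ideal `I`: the monomials
of `I` that are minimal with respect to divisibility. -/
def minGens (I : Ideal (MvPolynomial σ K)) : Set (σ →₀ ℕ) :=
  {a | Minimal (· ∈ exponents I) a}

/-- A monomial ideal is equigenerated if its minimal monomial generators all have the same
degree. -/
def IsEquigenerated (I : Ideal (MvPolynomial σ K)) : Prop :=
  ∃ d : ℕ, ∀ a ∈ minGens I, a.degree = d

/-- `α(I)`, the least degree `d` for which `I` has a nonzero homogeneous element of degree `d`
(for a nonzero homogeneous ideal `I`). -/
def initialDegree (I : Ideal (MvPolynomial σ K)) : ℕ :=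
  sInf {d : ℕ | ∃ f ∈ I, f ≠ 0 ∧ f.IsHomogeneous d}

/-- The symbolic polyhedron of a monomial ideal `I`: the intersection, over the maximal associated
primes `P` of `I`, of the convex hulls of the exponent sets of `Q_{⊆P} = R ∩ I R_P`. -/
def symbolicPolyhedron (I : Ideal (MvPolynomial σ K)) : Set (σ → ℝ) :=
  ⋂ P ∈ maxAss I, convexHull ℝ
    ((fun (a : σ →₀ ℕ) (i : σ) => (a i : ℝ)) '' exponents (localContraction I P))

end Polynomial

/-- `α(Q)`, the minimum of the coordinate sum over a nonempty polyhedron `Q` contained in the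
nonnegative orthant. (On such a set the minimum exists, so it is the infimum.) -/
def polyhedronAlpha {σ : Type*} [Fintype σ] (Q : Set (σ → ℝ)) : ℝ :=
  sInf ((fun a : σ → ℝ => ∑ i, a i) '' Q)

end

end MonomialSymbolic

/-! Let `x^a` occur in an element of `I^(er)`. At each associated prime `P`, on the coordinates of
the variables in `P`, `a` dominates a sum of `er` exponents of `I`. There are at most `ht P ≤ e`
such variables, so a Carathéodory reduction (`exists_smul_le_of_sum_smul_le`) concentrates weight at
least `r` on one exponent. Hence `⌊a/r⌋` lies in every localization of `I`, so in `I`, and `x^(rg)`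
divides `x^a` for some minimal generator `x^g`. Degrees do the rest: `a/(er)` lies in the symbolic
polyhedron, so `|a| ≥ r(α(I) + e - 1)`, while equigeneration gives `|g| ≤ α(I)`. The cofactor thus
has degree at least `(e - 1)r`. -/

namespace MonomialSymbolic

/-! ### Carathéodory reduction -/

section Caratheodory

/-- A Carathéodory-type statement: if a nonnegative combination of nonnegative vectors in a space of
dimension at most `D` has total weight at least `D * r` and is bounded by `b`, then `r` times one of
the vectors is bounded by `b`. -/
theorem exists_smul_le_of_sum_smul_le {ι κ : Type*} [Finite κ] (v : ι → κ → ℝ)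
    (hv : ∀ i, 0 ≤ v i) {r : ℝ} (hr : 0 ≤ r) {D : ℕ} (hD : Nat.card κ ≤ D) (b : κ → ℝ)
    (t : Finset ι) (ht : t.Nonempty) (w : ι → ℝ) (hw : ∀ i ∈ t, 0 ≤ w i)
    (hsum : D * r ≤ ∑ i ∈ t, w i) (hb : ∑ i ∈ t, w i • v i ≤ b) :
    ∃ i ∈ t, r • v i ≤ b := by
  classical
  cases nonempty_fintype κ
  induction t using Finset.strongInduction generalizing w with
  | H t ih =>
  have hb0 : 0 ≤ b := (Finset.sum_nonneg fun i hi => smul_nonneg (hw i hi) (hv i)).trans hb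
  by_cases hzero : ∃ i ∈ t, v i = 0
  · obtain ⟨i, hi, h0⟩ := hzero
    exact ⟨i, hi, by simpa [h0] using hb0⟩
  push Not at hzero
  -- With at most `D` vectors, some weight is at least the average, hence at least `r`.
  by_cases hcard : t.card ≤ D
  · have : ∑ i ∈ t, r ≤ ∑ i ∈ t, w i := by
      refine le_trans ?_ hsum
      rw [Finset.sum_const, nsmul_eq_mul]
      gcongr
    obtain ⟨i, hi, hri⟩ := Finset.exists_le_of_sum_le ht this
    refine ⟨i, hi, le_trans (smul_le_smul_of_nonneg_right hri (hv i)) (le_trans ?_ hb)⟩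
    exact Finset.single_le_sum (f := fun i => w i • v i)
      (fun i hi => smul_nonneg (hw i hi) (hv i)) hi
  have hdep : ¬ LinearIndepOn ℝ v (t : Set ι) := by
    intro h
    have h1 : Fintype.card t ≤ Module.finrank ℝ (κ → ℝ) := h.fintype_card_le_finrank
    rw [Module.finrank_fintype_fun_eq_card, ← Nat.card_eq_fintype_card (α := κ),
      Fintype.card_coe] at h1
    omega
  rw [not_linearIndepOn_finset_iff] at hdep
  -- The sign of the relation is chosen so that moving along it cannot lower the total weight.
  obtain ⟨μ, hμ, hμsum, hμne⟩ : ∃ μ : ι → ℝ, ∑ i ∈ t, μ i • v i = 0 ∧ 0 ≤ ∑ i ∈ t, μ i ∧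
      ∃ i ∈ t, μ i ≠ 0 := by
    obtain ⟨μ, h1, i, hi, h2⟩ := hdep
    rcases le_total 0 (∑ i ∈ t, μ i) with h | h
    · exact ⟨μ, h1, h, i, hi, h2⟩
    · exact ⟨fun i => -μ i, by simp [h1], by simpa using h, i, hi, by simpa using h2⟩
  have hneg : (t.filter fun i => μ i < 0).Nonempty := by
    by_contra hne
    rw [Finset.not_nonempty_iff_eq_empty, Finset.filter_eq_empty_iff] at hne
    push Not at hne
    obtain ⟨i, hi, hi0⟩ := hμne
    have := (Finset.sum_eq_zero_iff_of_nonneg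
      (fun i hi => smul_nonneg (hne hi) (hv i))).1 hμ i hi
    exact hzero i hi ((smul_eq_zero.1 this).resolve_left hi0)
  -- The minimal ratio is the longest step keeping all weights nonnegative; it makes the weight of
  -- `j` vanish.
  obtain ⟨j, hj, hmin⟩ := Finset.exists_min_image _ (fun i => w i / (-μ i)) hneg
  rw [Finset.mem_filter] at hj
  set τ := w j / (-μ j) with hτ
  have hτ0 : 0 ≤ τ := div_nonneg (hw j hj.1) (by linarith [hj.2])
  have hwj : w j + τ * μ j = 0 := by
    have := hj.2.ne
    rw [hτ]; field_simp; ring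
  have hne : (t.erase j).Nonempty := by
    by_contra hempty
    rw [Finset.not_nonempty_iff_eq_empty, Finset.erase_eq_empty_iff] at hempty
    rcases hempty with h | h
    · simp [h] at ht
    · rw [h, Finset.sum_singleton] at hμ
      exact hzero j hj.1 ((smul_eq_zero.1 hμ).resolve_left hj.2.ne)
  have hw' : ∀ i ∈ t.erase j, 0 ≤ w i + τ * μ i := by
    intro i hi
    have hit := Finset.mem_of_mem_erase hi
    rcases lt_or_ge (μ i) 0 with h | h
    · have := hmin i (Finset.mem_filter.2 ⟨hit, h⟩)
      rw [le_div_iff₀ (by linarith)] at this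
      linarith
    · have := hw i hit
      positivity
  have hsum' : D * r ≤ ∑ i ∈ t.erase j, (w i + τ * μ i) := by
    rw [Finset.sum_erase (f := fun i => w i + τ * μ i) _ hwj,
      Finset.sum_add_distrib, ← Finset.mul_sum]
    nlinarith
  have hb' : ∑ i ∈ t.erase j, (w i + τ * μ i) • v i ≤ b := by
    rw [Finset.sum_erase _ (by simp [hwj])]
    simp only [add_smul, Finset.sum_add_distrib, mul_smul, ← Finset.smul_sum, hμ]
    simpa using hb
  obtain ⟨i, hi, hri⟩ := ih (t.erase j) (Finset.erase_ssubset hj.1) hne _ hw' hsum' hb'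
  exact ⟨i, Finset.mem_of_mem_erase hi, hri⟩

end Caratheodory

/-! ### Associated primes and localization -/

section General

variable {R : Type*} [CommRing R]

theorem mem_localContraction {J : Ideal R} {P : PrimeSpectrum R} {f : R} :
    f ∈ localContraction J P ↔ ∃ s ∉ P.asIdeal, s * f ∈ J := by
  rw [localContraction, Ideal.mem_comap,
    IsLocalization.algebraMap_mem_map_algebraMap_iff P.asIdeal.primeCompl]
  rfl

/-- The annihilator of a nonzero class in `R/I` lies in some associated prime `P`, so nothing
outside `P` kills that class. -/
theorem mem_of_forall_mem_localContraction [IsNoetherianRing R] {I : Ideal R} {f : R}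
    (h : ∀ P ∈ ass I, f ∈ localContraction I P) : f ∈ I := by
  by_contra hf
  have hne : Ideal.Quotient.mk I f ≠ 0 := by rwa [Ne, Ideal.Quotient.eq_zero_iff_mem]
  obtain ⟨P, hP, hle⟩ := exists_le_isAssociatedPrime_of_isNoetherianRing R _ hne
  obtain ⟨s, hs, hsf⟩ := mem_localContraction.1 (h ⟨P, hP.isPrime⟩ hP)
  refine hs (hle ?_)
  rw [Submodule.mem_colon_singleton, Submodule.mem_bot]
  change Ideal.Quotient.mk I (s * f) = 0
  rwa [Ideal.Quotient.eq_zero_iff_mem]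

theorem maxAss_nonempty [IsNoetherianRing R] {I : Ideal R} (hI : I ≠ ⊤) : (maxAss I).Nonempty := by
  have := Ideal.Quotient.nontrivial_iff.2 hI
  obtain ⟨P, hP⟩ := associatedPrimes.nonempty R (R ⧸ I)
  have hne : (ass I).Nonempty := ⟨⟨P, IsAssociatedPrime.isPrime hP⟩, hP⟩
  obtain ⟨M, hM, hmax⟩ := WellFounded.has_min
    (InvImage.wf PrimeSpectrum.asIdeal
      (wellFounded_gt : WellFounded ((· > ·) : Ideal R → Ideal R → Prop))) _ hne
  exact ⟨M, hM, fun Q hQ hMQ => (eq_or_lt_of_le hMQ).elim (fun h => h.ge)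
    fun h => absurd h (hmax Q hQ)⟩

theorem le_of_mem_ass {I : Ideal R} {P : PrimeSpectrum R} (hP : P ∈ ass I) : I ≤ P.asIdeal := by
  obtain ⟨_, x, hx⟩ := hP
  rw [hx]
  refine le_trans ?_ Ideal.le_radical
  intro s hs
  rw [Submodule.mem_colon_singleton, Submodule.mem_bot]
  obtain ⟨y, rfl⟩ := Ideal.Quotient.mk_surjective x
  change Ideal.Quotient.mk I (s * y) = 0
  rw [Ideal.Quotient.eq_zero_iff_mem]
  exact I.mul_mem_right _ hs

theorem one_le_of_bigHeight_eq [IsDomain R] [IsNoetherianRing R] {I : Ideal R} (hbot : I ≠ ⊥)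
    (htop : I ≠ ⊤) {e : ℕ} (he : bigHeight I = e) : 1 ≤ e := by
  obtain ⟨P, hP⟩ := maxAss_nonempty htop
  have hPass : P ∈ ass I := hP.1
  have hlt : (⊥ : Ideal R) < P.asIdeal := (bot_lt_iff_ne_bot.2 hbot).trans_le (le_of_mem_ass hPass)
  have h1 := Ideal.height_add_one_le_of_lt_of_isPrime hlt
  have h2 : P.asIdeal.height ≤ bigHeight I := le_iSup₂_of_le P hPass le_rfl
  rw [he] at h2
  exact_mod_cast (le_add_self.trans h1).trans h2

end General

/-! ### Variables in a prime and its height -/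

section Variables

variable {σ K : Type*} [Field K]

/-- The endomorphism of the polynomial ring which sends the variables in `S` to zero. -/
noncomputable def killVars (S : Set σ) : MvPolynomial σ K →ₐ[K] MvPolynomial σ K :=
  open Classical in aeval fun i => if i ∈ S then 0 else X i

theorem killVars_X_of_mem {S : Set σ} {i : σ} (h : i ∈ S) :
    killVars (K := K) S (X i) = 0 := by simp [killVars, h]

theorem killVars_X_of_notMem {S : Set σ} {i : σ} (h : i ∉ S) :
    killVars (K := K) S (X i) = X i := by simp [killVars, h]

/-- Modulo `P` the variables in `S` are already zero, so the quotient map factors through `killVars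
S`. -/
theorem ker_killVars_le {S : Set σ} {P : Ideal (MvPolynomial σ K)} (hS : ∀ i ∈ S, X i ∈ P) :
    RingHom.ker (killVars (K := K) S) ≤ P := by
  have h : (Ideal.Quotient.mkₐ K P).comp (killVars S) = Ideal.Quotient.mkₐ K P := by
    refine MvPolynomial.algHom_ext fun i => ?_
    by_cases hi : i ∈ S
    · simp [killVars_X_of_mem hi, Ideal.Quotient.eq_zero_iff_mem.2 (hS i hi)]
    · simp [killVars_X_of_notMem hi]
  intro f hf
  rw [RingHom.mem_ker] at hf
  have := DFunLike.congr_fun h f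
  rw [AlgHom.comp_apply, hf, map_zero] at this
  exact Ideal.Quotient.eq_zero_iff_mem.1 this.symm

/-- Killing one more variable gives a strictly larger prime kernel. -/
theorem card_le_height_ker_killVars (S : Finset σ) :
    (S.card : ℕ∞) ≤ (RingHom.ker (killVars (K := K) (S : Set σ))).height := by
  classical
  induction S using Finset.induction_on with
  | empty => simp
  | insert i S hi ih =>
    have := RingHom.ker_isPrime (killVars (K := K) (S : Set σ))
    have := RingHom.ker_isPrime (killVars (K := K) ((insert i S : Finset σ) : Set σ))
    have hlt : RingHom.ker (killVars (K := K) (S : Set σ)) <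
        RingHom.ker (killVars (K := K) ((insert i S : Finset σ) : Set σ)) := by
      refine lt_of_le_not_ge (ker_killVars_le fun j hj => ?_) fun hle => ?_
      · exact killVars_X_of_mem (by simpa using Or.inr hj)
      · have hmem : (X i : MvPolynomial σ K) ∈ RingHom.ker (killVars (K := K) (S : Set σ)) :=
          hle (killVars_X_of_mem (by simp))
        rw [RingHom.mem_ker, killVars_X_of_notMem (by simpa using hi)] at hmem
        exact X_ne_zero i hmem
    rw [Finset.card_insert_of_notMem hi, Nat.cast_add, Nat.cast_one]
    exact (add_le_add_left ih 1).trans (Ideal.height_add_one_le_of_lt_of_isPrime hlt)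

theorem card_vars_mem_le_height [Finite σ] (P : Ideal (MvPolynomial σ K)) [P.IsPrime] :
    (Nat.card {i : σ // (X i : MvPolynomial σ K) ∈ P} : ℕ∞) ≤ P.height := by
  classical
  cases nonempty_fintype σ
  rw [Nat.card_eq_fintype_card, Fintype.card_subtype]
  exact (card_le_height_ker_killVars _).trans
    (Ideal.height_mono (ker_killVars_le fun i hi => by simpa using hi))

theorem monomial_notMem_of_isPrime {P : Ideal (MvPolynomial σ K)} (hP : P.IsPrime) {c : σ →₀ ℕ}
    (hc : ∀ i, (X i : MvPolynomial σ K) ∈ P → c i = 0) : monomial c (1 : K) ∉ P := by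
  rw [monomial_eq, C_1, one_mul, Finsupp.prod, hP.prod_mem_iff]
  rintro ⟨i, hi, h⟩
  exact (Finsupp.mem_support_iff.1 hi) (hc i (hP.mem_of_pow_mem _ h))

theorem exists_mem_support_of_notMem {P : Ideal (MvPolynomial σ K)} {s : MvPolynomial σ K}
    (hs : s ∉ P) : ∃ c ∈ s.support, ∀ i, (X i : MvPolynomial σ K) ∈ P → c i = 0 := by
  by_contra! h
  refine hs ?_
  have : s ∈ Ideal.span (X '' {i | (X i : MvPolynomial σ K) ∈ P}) :=
    mem_ideal_span_X_image.2 fun m hm => h m hm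
  refine Ideal.span_le.2 ?_ this
  rintro _ ⟨i, hi, rfl⟩
  exact hi

end Variables

end MonomialSymbolic

namespace MonomialSymbolic

/-! ### Exponents of monomial ideals -/

section Monomial

variable {σ K : Type*} [Field K] {I J : Ideal (MvPolynomial σ K)}

theorem exponents_mono_left {a b : σ →₀ ℕ} (ha : a ∈ exponents I) (hab : a ≤ b) :
    b ∈ exponents I := by
  obtain ⟨c, rfl⟩ := exists_add_of_le hab
  have : monomial (a + c) (1 : K) = monomial a 1 * monomial c 1 := by
    rw [monomial_mul, mul_one]
  rw [exponents, Set.mem_ofPred_eq, this]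
  exact I.mul_mem_right _ ha

theorem mem_of_support_subset_exponents {f : MvPolynomial σ K}
    (h : ∀ a ∈ f.support, a ∈ exponents I) : f ∈ I := by
  rw [f.as_sum]
  refine I.sum_mem fun a ha => ?_
  have : monomial a (f.coeff a) = C (f.coeff a) * monomial a 1 := by rw [C_mul_monomial, mul_one]
  rw [this]
  exact I.mul_mem_left _ (h a ha)

theorem IsMonomialIdeal.mem_exponents (hI : IsMonomialIdeal I) {f : MvPolynomial σ K} (hf : f ∈ I)
    {a : σ →₀ ℕ} (ha : a ∈ f.support) : a ∈ exponents I := by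
  obtain ⟨S, rfl⟩ := hI
  obtain ⟨b, hb, hba⟩ := mem_ideal_span_monomial_image.1 hf a ha
  exact exponents_mono_left (Ideal.subset_span ⟨b, hb, rfl⟩) hba

theorem IsMonomialIdeal.exists_pow_eq_span (hI : IsMonomialIdeal I) (m : ℕ) :
    ∃ A : Set (σ →₀ ℕ), I ^ m = Ideal.span ((fun a => monomial a (1 : K)) '' A) ∧
      ∀ a ∈ A, ∃ g : Fin m → (σ →₀ ℕ), (∀ i, g i ∈ exponents I) ∧ ∑ i, g i = a := by
  induction m with
  | zero =>
    exact ⟨{0}, by simp [Ideal.one_eq_top],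
      fun a ha => ⟨fun _ => 0, by simp, by simpa using ha.symm⟩⟩
  | succ m ih =>
    obtain ⟨A, hA, hAg⟩ := ih
    obtain ⟨S, hS⟩ := hI
    refine ⟨Set.image2 (· + ·) A S, ?_, ?_⟩
    · rw [pow_succ, hA, hS, Ideal.span_mul_span', ← Set.image2_mul, Set.image2_image_left,
        Set.image2_image_right, Set.image_image2]
      simp [monomial_mul]
    · rintro _ ⟨a, ha, b, hb, rfl⟩
      obtain ⟨g, hg, rfl⟩ := hAg a ha
      refine ⟨Fin.snoc g b, fun i => ?_, by simp [Fin.sum_univ_castSucc]⟩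
      refine Fin.lastCases ?_ (fun j => ?_) i
      · rw [Fin.snoc_last, hS]
        exact Ideal.subset_span ⟨b, hb, rfl⟩
      · rw [Fin.snoc_castSucc]
        exact hg j

theorem IsMonomialIdeal.pow (hI : IsMonomialIdeal I) (m : ℕ) : IsMonomialIdeal (I ^ m) :=
  let ⟨A, hA, _⟩ := hI.exists_pow_eq_span m
  ⟨A, hA⟩

theorem IsMonomialIdeal.exists_sum_le_of_mem_exponents_pow (hI : IsMonomialIdeal I) {m : ℕ}
    {a : σ →₀ ℕ} (ha : a ∈ exponents (I ^ m)) :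
    ∃ g : Fin m → (σ →₀ ℕ), (∀ i, g i ∈ exponents I) ∧ ∑ i, g i ≤ a := by
  classical
  obtain ⟨A, hA, hAg⟩ := hI.exists_pow_eq_span m
  rw [exponents, Set.mem_ofPred_eq, hA, mem_ideal_span_monomial_image] at ha
  obtain ⟨b, hb, hba⟩ := ha a (by simp [coeff_monomial])
  obtain ⟨g, hg, rfl⟩ := hAg b hb
  exact ⟨g, hg, hba⟩

theorem nsmul_mem_exponents_pow {a : σ →₀ ℕ} (ha : a ∈ exponents I) (m : ℕ) :
    m • a ∈ exponents (I ^ m) := by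
  have : monomial (m • a) (1 : K) = monomial a 1 ^ m := by rw [monomial_pow, one_pow]
  rw [exponents, Set.mem_ofPred_eq, this]
  exact Ideal.pow_mem_pow ha m

theorem exists_minGens_le {a : σ →₀ ℕ} (ha : a ∈ exponents I) : ∃ b ∈ minGens I, b ≤ a := by
  obtain ⟨b, hb, hmin⟩ := exists_minimal_le_of_wellFoundedLT (· ∈ exponents I) a ha
  exact ⟨b, hmin, hb⟩

/-- If a monomial ideal contains a multiple of `f` by an element outside the prime `P`, then, up to
multiplication by variables outside `P`, it contains every monomial of `f`. -/
theorem IsMonomialIdeal.exists_add_mem_exponents [Finite σ] (hJ : IsMonomialIdeal J)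
    {P : Ideal (MvPolynomial σ K)} {s f : MvPolynomial σ K} (hs : s ∉ P) (hsf : s * f ∈ J)
    {a : σ →₀ ℕ} (ha : a ∈ f.support) :
    ∃ c : σ →₀ ℕ, (∀ i, (X i : MvPolynomial σ K) ∈ P → c i = 0) ∧ a + c ∈ exponents J := by
  classical
  cases nonempty_fintype σ
  let : LinearOrder σ := linearOrderOfSTO WellOrderingRel
  set T : Set (σ →₀ ℕ) := {a | ∃ c : σ →₀ ℕ, (∀ i, (X i : MvPolynomial σ K) ∈ P → c i = 0) ∧
    a + c ∈ exponents J}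
  by_contra hbad
  have hTup : ∀ {x y : σ →₀ ℕ}, x ∈ T → x + y ∈ T := by
    rintro x y ⟨c, hc, hxc⟩
    exact ⟨c, hc, exponents_mono_left hxc (by rw [add_right_comm]; exact le_self_add)⟩
  -- A monomial order comparing the degree in the variables of `P` first, so that the lowest term of
  -- `s` involves none of them.
  let key : (σ →₀ ℕ) → ℕ ×ₗ Lex (σ →₀ ℕ) := fun x =>
    toLex (∑ i with (X i : MvPolynomial σ K) ∈ P, x i, toLex x)
  have key_add : ∀ x y, key (x + y) = key x + key y := fun x y => by
    simp only [key, Finsupp.add_apply, Finset.sum_add_distrib]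
    rfl
  have key_inj : Function.Injective key := fun x y h => by
    simpa [key] using congrArg (fun z => ofLex (ofLex z).2) h
  obtain ⟨a₀, ha₀, hamin⟩ := Finset.exists_min_image (f.support.filter (· ∉ T)) key
    ⟨a, Finset.mem_filter.2 ⟨ha, hbad⟩⟩
  rw [Finset.mem_filter] at ha₀
  obtain ⟨c, hcs, hc⟩ := exists_mem_support_of_notMem hs
  obtain ⟨b₀, hb₀, hbmin⟩ := Finset.exists_min_image s.support key ⟨c, hcs⟩
  have hb₀P : ∀ i, (X i : MvPolynomial σ K) ∈ P → b₀ i = 0 := by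
    have h1 := hbmin c hcs
    rw [Prod.Lex.le_iff] at h1
    have h2 : ∑ i with (X i : MvPolynomial σ K) ∈ P, c i = 0 :=
      Finset.sum_eq_zero fun i hi => hc i (Finset.mem_filter.1 hi).2
    have h3 : ∑ i with (X i : MvPolynomial σ K) ∈ P, b₀ i = 0 := by
      have : ∑ i with (X i : MvPolynomial σ K) ∈ P, b₀ i ≤
          ∑ i with (X i : MvPolynomial σ K) ∈ P, c i := h1.elim (fun h => h.le) fun h => h.1.le
      omega
    intro i hi
    exact Finset.sum_eq_zero_iff.1 h3 i (Finset.mem_filter.2 ⟨Finset.mem_univ _, hi⟩)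
  have hnot : b₀ + a₀ ∉ exponents J := fun h => ha₀.2 ⟨b₀, hb₀P, by rwa [add_comm]⟩
  -- The lowest term of `s` times the lowest bad term of `f` cannot cancel: a good term of `f`
  -- contributing here would make `a₀` good, and bad terms are excluded by minimality.
  have hcoeff : (s * f).coeff (b₀ + a₀) = s.coeff b₀ * f.coeff a₀ := by
    rw [coeff_mul]
    refine Finset.sum_eq_single (b₀, a₀) ?_ fun h => absurd (by simp) h
    rintro ⟨x, y⟩ hxy hne
    rw [Finset.HasAntidiagonal.mem_antidiagonal] at hxy
    dsimp only at hxy ⊢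
    by_contra hmul
    have hx : x ∈ s.support := mem_support_iff.2 (left_ne_zero_of_mul hmul)
    have hy : y ∈ f.support := mem_support_iff.2 (right_ne_zero_of_mul hmul)
    have hyT : y ∉ T := by
      intro hyT
      have := hTup (y := x) hyT
      rw [add_comm, hxy] at this
      obtain ⟨d, hd, hmem⟩ := this
      exact ha₀.2 ⟨b₀ + d, fun i hi => by simp [hb₀P i hi, hd i hi], by
        rwa [← add_assoc, add_comm a₀]⟩
    have h1 := hbmin x hx
    have h2 := hamin y (Finset.mem_filter.2 ⟨hy, hyT⟩)
    have h3 : key x + key y = key b₀ + key a₀ := by rw [← key_add, ← key_add, hxy]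
    obtain ⟨h4, h5⟩ := (add_eq_add_iff_eq_and_eq h1 h2).1 h3.symm
    exact hne (by rw [key_inj h4, key_inj h5])
  refine hnot (hJ.mem_exponents hsf (mem_support_iff.2 ?_))
  rw [hcoeff]
  exact mul_ne_zero (mem_support_iff.1 hb₀) (mem_support_iff.1 ha₀.1)

theorem IsMonomialIdeal.le_initialDegree (hI : IsMonomialIdeal I) (hbot : I ≠ ⊥) {d : ℕ}
    (hd : ∀ a ∈ minGens I, a.degree = d) : d ≤ initialDegree I := by
  have hle : ∀ {a}, a ∈ exponents I → d ≤ a.degree := fun ha => by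
    obtain ⟨b, hb, hba⟩ := exists_minGens_le ha
    exact (hd b hb).symm.le.trans (Finsupp.degree_mono hba)
  obtain ⟨f, hf, hf0⟩ := Submodule.exists_mem_ne_zero_of_ne_bot hbot
  obtain ⟨a, ha⟩ := support_nonempty.2 hf0
  -- The witness is needed because `sInf ∅ = 0` in `ℕ`.
  refine le_csInf ⟨a.degree, monomial a 1, hI.mem_exponents hf ha, by simp,
    isHomogeneous_monomial _ rfl⟩ ?_
  rintro k ⟨g, hg, hg0, hgk⟩
  obtain ⟨c, hc⟩ := support_nonempty.2 hg0
  have h1 := hle (hI.mem_exponents hg hc)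
  rw [Finsupp.degree_eq_weight_one] at h1
  exact h1.trans_eq (hgk (mem_support_iff.1 hc))

end Monomial

end MonomialSymbolic

namespace MonomialSymbolic

theorem mem_exponents_localContraction {σ K : Type*} [Field K] {I : Ideal (MvPolynomial σ K)}
    {P : PrimeSpectrum (MvPolynomial σ K)} {a b : σ →₀ ℕ} (ha : a ∈ exponents I)
    (hab : ∀ i, (X i : MvPolynomial σ K) ∈ P.asIdeal → a i ≤ b i) :
    b ∈ exponents (localContraction I P) := by
  -- The truncated difference involves only variables outside `P`, which become units.
  refine mem_localContraction.2 ⟨monomial (a - b) 1, monomial_notMem_of_isPrime P.2 fun i hi => ?_,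
    ?_⟩
  · exact Nat.sub_eq_zero_of_le (hab i hi)
  · rw [monomial_mul, mul_one]
    exact exponents_mono_left ha fun i => by simp; omega

/-! ### Dividing exponents of the symbolic power by `r` -/

section Containment

variable {σ K : Type*} [Finite σ] [Field K] {I : Ideal (MvPolynomial σ K)}

theorem IsMonomialIdeal.exists_sum_le_of_mem_localContraction_pow (hI : IsMonomialIdeal I)
    {P : PrimeSpectrum (MvPolynomial σ K)} {m : ℕ} {f : MvPolynomial σ K}
    (hf : f ∈ localContraction (I ^ m) P) {a : σ →₀ ℕ} (ha : a ∈ f.support) :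
    ∃ g : Fin m → (σ →₀ ℕ), (∀ j, g j ∈ exponents I) ∧
      ∀ i, (X i : MvPolynomial σ K) ∈ P.asIdeal → ∑ j, g j i ≤ a i := by
  obtain ⟨s, hs, hsf⟩ := mem_localContraction.1 hf
  obtain ⟨c, hc, hac⟩ := (hI.pow m).exists_add_mem_exponents hs hsf ha
  obtain ⟨g, hg, hle⟩ := hI.exists_sum_le_of_mem_exponents_pow hac
  refine ⟨g, hg, fun i hi => ?_⟩
  simpa [hc i hi] using hle i

/-- The exponents of the monomials in the `e r`-th symbolic power of `I`, divided by `r` and rounded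
down, are exponents of monomials in `I`, where `e` is the big-height of `I`. -/
theorem IsMonomialIdeal.exists_nsmul_le_of_mem_symbolicPower (hI : IsMonomialIdeal I)
    {e r : ℕ} (he : bigHeight I = e) (hepos : 1 ≤ e) (hr : 1 ≤ r) {f : MvPolynomial σ K}
    (hf : f ∈ symbolicPower I (e * r)) {a : σ →₀ ℕ} (ha : a ∈ f.support) :
    ∃ b ∈ exponents I, r • b ≤ a := by
  -- The dominated exponent found below depends on `P`; the floor dominates all of them on the
  -- relevant coordinates.
  refine ⟨a.mapRange (· / r) (Nat.zero_div r), ?_, fun i => by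
    simpa using Nat.mul_div_le (a i) r⟩
  refine mem_of_forall_mem_localContraction fun P hP => ?_
  have hfP : f ∈ localContraction (I ^ (e * r)) P := by
    simp only [symbolicPower, Submodule.mem_iInf] at hf
    exact hf P hP
  obtain ⟨g, hg, hle⟩ := hI.exists_sum_le_of_mem_localContraction_pow hfP ha
  have hcard : Nat.card {i : σ // (X i : MvPolynomial σ K) ∈ P.asIdeal} ≤ e := by
    have h1 : P.asIdeal.height ≤ bigHeight I := le_iSup₂_of_le P hP le_rfl
    rw [he] at h1
    exact_mod_cast (card_vars_mem_le_height P.asIdeal).trans h1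
  have : NeZero (e * r) := ⟨by positivity⟩
  obtain ⟨j, -, hj⟩ := exists_smul_le_of_sum_smul_le
    (fun (j : Fin (e * r)) (i : {i : σ // (X i : MvPolynomial σ K) ∈ P.asIdeal}) => (g j i : ℝ))
    (fun j i => Nat.cast_nonneg _) (Nat.cast_nonneg r) hcard (fun i => (a i : ℝ)) Finset.univ
    Finset.univ_nonempty (fun _ => 1) (fun _ _ => zero_le_one) (by simp) (fun i => by
      simpa using mod_cast hle i.1 i.2)
  refine mem_exponents_localContraction (hg j) fun i hi => ?_
  have := hj ⟨i, hi⟩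
  simp only [Pi.smul_apply, smul_eq_mul] at this
  rw [Finsupp.mapRange_apply, Nat.le_div_iff_mul_le hr, mul_comm]
  exact_mod_cast this

end Containment

theorem nonneg_of_mem_convexHull_exponents {σ K : Type*} [Field K]
    {J : Ideal (MvPolynomial σ K)} {x : σ → ℝ}
    (hx : x ∈ convexHull ℝ ((fun (a : σ →₀ ℕ) (i : σ) => (a i : ℝ)) '' exponents J)) : 0 ≤ x := by
  refine convexHull_min ?_ (convex_Ici (0 : σ → ℝ)) hx
  rintro _ ⟨a, _, rfl⟩ i
  exact Nat.cast_nonneg _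

/-! ### Degree bound from the symbolic polyhedron -/

section Polyhedron

variable {σ K : Type*} [Fintype σ] [Field K] {I : Ideal (MvPolynomial σ K)}

theorem IsMonomialIdeal.smul_mem_symbolicPolyhedron (hI : IsMonomialIdeal I) {m : ℕ} (hm : m ≠ 0)
    {f : MvPolynomial σ K} (hf : f ∈ symbolicPower I m) {a : σ →₀ ℕ} (ha : a ∈ f.support) :
    (m : ℝ)⁻¹ • (fun i => (a i : ℝ)) ∈ symbolicPolyhedron I := by
  classical
  refine Set.mem_iInter₂.2 fun P hP => ?_
  have hfP : f ∈ localContraction (I ^ m) P := by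
    simp only [symbolicPower, Submodule.mem_iInf] at hf
    exact hf P hP.1
  obtain ⟨g, hg, hle⟩ := hI.exists_sum_le_of_mem_localContraction_pow hfP ha
  have : NeZero m := ⟨hm⟩
  let g' : Fin m → (σ →₀ ℕ) := fun j => (g j).filter fun i => (X i : MvPolynomial σ K) ∈ P.asIdeal
  have hg' : ∑ j, g' j ≤ a := fun i => by
    rw [Finsupp.finsetSum_apply]
    by_cases hi : (X i : MvPolynomial σ K) ∈ P.asIdeal
    · simpa [g', hi] using hle i hi
    · simp [g', hi]
  obtain ⟨b, hb⟩ := exists_add_of_le hg'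
  -- Adding the leftover to one summand makes `a` an exact sum, so `a/m` is an average of exponents
  -- of the localization.
  let h : Fin m → (σ →₀ ℕ) := fun j => g' j + if j = 0 then b else 0
  have hh : ∑ j, h j = a := by simp [h, Finset.sum_add_distrib, hb]
  have hhmem : ∀ j, h j ∈ exponents (localContraction I P) := fun j =>
    mem_exponents_localContraction (hg j) fun i hi => by simp [h, g', hi]
  have key := (convex_convexHull ℝ
    ((fun (a : σ →₀ ℕ) (i : σ) => (a i : ℝ)) '' exponents (localContraction I P))).sum_mem
    (t := Finset.univ) (w := fun _ : Fin m => (m : ℝ)⁻¹) (z := fun j i => (h j i : ℝ))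
    (fun _ _ => by positivity) (by simp [hm])
    (fun j _ => subset_convexHull ℝ _ ⟨h j, hhmem j, rfl⟩)
  rw [← Finset.smul_sum] at key
  convert key using 2
  ext i
  rw [← hh, Finsupp.finsetSum_apply, Finset.sum_apply]
  push_cast
  rfl

theorem IsMonomialIdeal.polyhedronAlpha_mul_le_degree (hI : IsMonomialIdeal I) (htop : I ≠ ⊤)
    {m : ℕ} (hm : m ≠ 0) {f : MvPolynomial σ K} (hf : f ∈ symbolicPower I m) {a : σ →₀ ℕ}
    (ha : a ∈ f.support) : m * polyhedronAlpha (symbolicPolyhedron I) ≤ a.degree := by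
  have hmem := hI.smul_mem_symbolicPolyhedron hm hf ha
  obtain ⟨P, hP⟩ := maxAss_nonempty htop
  -- A maximal associated prime confines the polyhedron to the nonnegative orthant, so the infimum
  -- is a true lower bound.
  have hbdd : BddBelow ((fun x : σ → ℝ => ∑ i, x i) '' symbolicPolyhedron I) := by
    refine ⟨0, ?_⟩
    rintro _ ⟨x, hx, rfl⟩
    exact Finset.sum_nonneg fun i _ =>
      nonneg_of_mem_convexHull_exponents (Set.mem_iInter₂.1 hx P hP) i
  have hle := csInf_le hbdd ⟨_, hmem, rfl⟩
  simp only [Pi.smul_apply, smul_eq_mul, ← Finset.mul_sum] at hle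
  rw [inv_mul_eq_div, le_div_iff₀ (by positivity), mul_comm] at hle
  rw [Finsupp.degree_eq_sum]
  push_cast
  exact hle

/-- Let `I` be a nonzero proper equigenerated monomial ideal of big-height `e`. If the initial degree
of the symbolic polyhedron of `I` is at least `(α(I) + e - 1) / e`, then the `e r`-th symbolic power
of `I` is contained in `𝔪 ^ ((e - 1) r) I ^ r`. -/
theorem IsMonomialIdeal.symbolicPower_le (hmon : IsMonomialIdeal I) (hbot : I ≠ ⊥) (htop : I ≠ ⊤)
    (hequi : IsEquigenerated I) {e : ℕ} (he : bigHeight I = e)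
    (hconj : ((initialDegree I : ℝ) + (e : ℝ) - 1) / (e : ℝ) ≤
      polyhedronAlpha (symbolicPolyhedron I)) (r : ℕ) :
    symbolicPower I (e * r) ≤ idealOfVars σ K ^ ((e - 1) * r) * I ^ r := by
  intro f hf
  have hepos : 1 ≤ e := one_le_of_bigHeight_eq hbot htop he
  rcases Nat.eq_zero_or_pos r with rfl | hr
  · simp [Ideal.one_eq_top]
  refine mem_of_support_subset_exponents fun a ha => ?_
  obtain ⟨d, hd⟩ := hequi
  obtain ⟨b, hb, hba⟩ := hmon.exists_nsmul_le_of_mem_symbolicPower he hepos hr hf ha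
  obtain ⟨g, hg, hgb⟩ := exists_minGens_le hb
  have hga : r • g ≤ a := (nsmul_le_nsmul_right hgb r).trans hba
  -- `|a| ≥ er·α(𝒬) ≥ r(α(I) + e - 1)` and `α(I) ≥ d`; removing `r • g` then costs exactly `rd`.
  have hdeg : r * (d + (e - 1)) ≤ a.degree := by
    have h1 := hmon.polyhedronAlpha_mul_le_degree htop (by positivity) hf ha
    have h2 : (d : ℝ) ≤ initialDegree I := mod_cast hmon.le_initialDegree hbot hd
    have he0 : (0 : ℝ) < e := mod_cast hepos
    rw [div_le_iff₀ he0] at hconj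
    have h3 : (r : ℝ) * (d + (e - 1)) ≤ a.degree := by
      refine le_trans ?_ h1
      push_cast
      have hr0 : (0 : ℝ) ≤ r := Nat.cast_nonneg r
      calc (r : ℝ) * (d + (e - 1)) ≤ r * (polyhedronAlpha (symbolicPolyhedron I) * e) :=
            mul_le_mul_of_nonneg_left (by linarith) hr0
        _ = _ := by ring
    rw [← Nat.cast_pred hepos] at h3
    exact_mod_cast h3
  obtain ⟨c, rfl⟩ := exists_add_of_le hga
  have hc : (e - 1) * r ≤ c.degree := by
    rw [map_add, map_nsmul, hd g hg, smul_eq_mul, mul_add, mul_comm r (e - 1)] at hdeg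
    omega
  change monomial (r • g + c) (1 : K) ∈ idealOfVars σ K ^ ((e - 1) * r) * I ^ r
  rw [add_comm, ← one_mul (1 : K), ← monomial_mul]
  exact Ideal.mul_mem_mul ((monomial_mem_pow_idealOfVars_iff _ c one_ne_zero).2 hc)
    (nsmul_mem_exponents_pow hg.prop r)

end Polyhedron

end MonomialSymbolic

theorem mainTheorem10 {K : Type*} [Field K] (n : ℕ)
    (I : Ideal (MvPolynomial (Fin (n + 1)) K))
    (hmon : MonomialSymbolic.IsMonomialIdeal I) (hbot : I ≠ ⊥) (htop : I ≠ ⊤)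
    (hequi : MonomialSymbolic.IsEquigenerated I)
    (e : ℕ) (he : MonomialSymbolic.bigHeight I = (e : ℕ∞))
    (hconj : ((MonomialSymbolic.initialDegree I : ℝ) + (e : ℝ) - 1) / (e : ℝ) ≤
      MonomialSymbolic.polyhedronAlpha (MonomialSymbolic.symbolicPolyhedron I)) :
    ∀ r : ℕ, MonomialSymbolic.symbolicPower I (e * r) ≤
      MvPolynomial.idealOfVars (Fin (n + 1)) K ^ ((e - 1) * r) * I ^ r := by
  exact hmon.symbolicPower_le hbot htop hequi he hconj
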